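/- All graphs are finite, simple and undirected. For a connected graph $G$ with $m_G$ edges, consider the simple random walk on $G$ (from each vertex, move to a uniformly chosen neighbour). Put $\pi_i = \deg_G(i)/(2m_G)$ (and $\pi_i=0$ if $G$ is a single vertex), and for $i \ne j$ let $m_{i,j}$ be the mean first passage time from $i$ to $j$, i.e. the expected number of steps until the walk started at $i$ first reaches $j$. Kemeny's constant of $G$ is $$\kappa(G)=\sum_{i}\sum_{j\ne i}\pi_i\, m_{i,j}\,\pi_j ,$$ and the accessibility index of a vertex $j$ of $G$ is $\alpha_G(j)=\sum_{i\neq j}\pi_i\, m_{i,j}$. Let $H$ be a connected graph, $k\ge 1$, and let $\mathcal T$ be a tree with vertex set $\{1,\dots,k\}$. A chain of $k$ copies of $H$ with respect to $\mathcal T$ is a graph obtained from $k$ disjoint copies $H_1,\dots,H_k$ of $H$ by choosing, for each edge $i\sim j$ of $\mathcal T$, a vertex of $H_i$ and a vertex of $H_j$, and joining these two vertices by an edge (these $k-1$ added edges are bridges; the choices for different edges of $\mathcal T$ are independent). Proposition. Let $H$ be a connected graph, and let $v\in V(H)$ be such that $\alpha_H(v)\le\alpha_H(w)$ for all $w\in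 V(H)$. Let $k\ge 1$. Then the minimum of $\kappa(G)$, over all trees $\mathcal T$ on $k$ vertices and all chains $G$ of $k$ copies of $H$ with respect to $\mathcal T$, is attained when $\mathcal T$ is a star (one vertex adjacent to all the others) and each of the $k-1$ added bridges joins the copies of $v$ in two copies of $H$. -/

import Mathlib

/-! ### First passage times of a finite Markov chain -/

open Classical in
/-- For the Markov chain with transition matrix `P`, the probability that, starting from `i`, the
chain reaches `j` for the first time (after time `0`) at time `n`. Conditioning on the first step,
`f 1 i = P i j` and `f (n + 1) i = ∑ l ≠ j, P i l * f n l`. -/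
noncomputable def firstPassageProb {V : Type*} [Fintype V] (P : Matrix V V ℝ) (j : V) :
    ℕ → V → ℝ
  | 0, _ => 0
  | 1, i => P i j
  | n + 2, i => ∑ l ∈ Finset.univ.filter (fun l => l ≠ j), P i l * firstPassageProb P j (n + 1) l

/-- The mean first passage time `m i j`: the expected number of steps until the chain started
at `i` reaches `j` for the first time. (The series converges when `P` is irreducible.) -/
noncomputable def meanFirstPassageTime {V : Type*} [Fintype V] (P : Matrix V V ℝ) (i j : V) : ℝ :=
  ∑' n : ℕ, (n : ℝ) * firstPassageProb P j n i

namespace SimpleGraph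

/-! ### The simple random walk on a finite graph -/

open Classical in
/-- Transition matrix of the simple random walk: from `i`, move to a uniformly chosen neighbour. -/
noncomputable def walkMatrix {V : Type*} [Fintype V] (G : SimpleGraph V) : Matrix V V ℝ :=
  fun i j => if G.Adj i j then 1 / (G.degree i : ℝ) else 0

open Classical in
/-- Stationary distribution of the simple random walk: `π i = deg i / (2 m)`, where `m` is the
number of edges. -/
noncomputable def walkStationary {V : Type*} [Fintype V] (G : SimpleGraph V) (i : V) : ℝ :=
  (G.degree i : ℝ) / (2 * (G.edgeFinset.card : ℝ))

open Classical in
/-- Kemeny's constant of the simple random walk: `κ(G) = ∑ i, ∑ j ≠ i, π i * m i j * π j`. -/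
noncomputable def kemenyConstant {V : Type*} [Fintype V] (G : SimpleGraph V) : ℝ :=
  ∑ i, ∑ j ∈ Finset.univ.filter (fun j => j ≠ i),
    G.walkStationary i * meanFirstPassageTime G.walkMatrix i j * G.walkStationary j

open Classical in
/-- Accessibility index of the vertex `j`: `α(j) = ∑ i ≠ j, π i * m i j`. -/
noncomputable def accessibilityIndex {V : Type*} [Fintype V] (G : SimpleGraph V) (j : V) : ℝ :=
  ∑ i ∈ Finset.univ.filter (fun i => i ≠ j),
    G.walkStationary i * meanFirstPassageTime G.walkMatrix i j

/-! ### Chains of copies of a graph -/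

/-- The chain of copies of `H` with respect to `T`: every vertex `i` of `T` is replaced by a copy
`{i} × V` of `H`, and every edge `i ~ j` of `T` by a single edge joining the vertex `a i j` of the
`i`-th copy to the vertex `a j i` of the `j`-th copy. The values of `a` at non-adjacent pairs play
no role. When `T` is a tree the added edges are bridges. -/
def chainOfCopies {V ι : Type*} (T : SimpleGraph ι) (H : SimpleGraph V) (a : ι → ι → V) :
    SimpleGraph (ι × V) where
  Adj p q := (p.1 = q.1 ∧ H.Adj p.2 q.2) ∨
    (T.Adj p.1 q.1 ∧ p.2 = a p.1 q.1 ∧ q.2 = a q.1 p.1)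
  symm := ⟨by
    rintro p q (⟨h, h'⟩ | ⟨h, h', h''⟩)
    · exact Or.inl ⟨h.symm, h'.symm⟩
    · exact Or.inr ⟨h.symm, h'', h'⟩⟩
  loopless := ⟨by
    rintro p (⟨-, h⟩ | ⟨h, -⟩)
    · exact H.irrefl h
    · exact T.irrefl h⟩

end SimpleGraph

/-! Write D for the sum of the degrees d_p of G and R for effective resistance. First step analysis
turns hitting times into solutions of Laplacian equations, whence κ(G) = (1/2D) ∑ d_p d_q R(p,q)
(`IsResistanceKernel.kemenyConstant_eq`). Likewise α_G(w) is ∑_p d_p R(p,w) minus a constant, so v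
minimizes ρ(w) = ∑_p d_p R_H(p,w) over H.

For a chain, D depends only on H and k, so only the double sum matters. Resistances add in series
along the tree: between copies i ≠ j, R is at least r(x,z) + dist(i,j) + r(w,y), with r the
resistance in H and z, w the bridge ends where the path leaves i and enters j. Weighted by degrees,
the terms in r are bounded below through ρ(v), with equality when all bridges sit at v
(`Connected.chainEnergy_le_degreeEnergy`, `Connected.degreeEnergy_eq_chainEnergy`). The remaining
sum of tree distances weighted by degrees is, for trees on k vertices, an increasing affine function
of the total distance (`IsTree.sum_sum_mul_dist`), which stars minimize.

Only the Laplacian of R enters the formula for κ, so any `IsResistanceKernel` will do: commute times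
serve for H, an explicit series formula for the chain. -/

section FirstPassage

/-! ### First step analysis for mean first passage times -/

open Classical in
/-- The probability that the chain started at `i` has not visited `j` at any of the times
`1, …, n`. -/
noncomputable def survivalProb {V : Type*} [Fintype V] (P : Matrix V V ℝ) (j : V) : ℕ → V → ℝ
  | 0, _ => 1
  | n + 1, i => ∑ l ∈ Finset.univ.filter (fun l => l ≠ j), P i l * survivalProb P j n l

open Classical

variable {V : Type*} [Fintype V] {P : Matrix V V ℝ} {j : V}

lemma survivalProb_nonneg (hP : ∀ i l, 0 ≤ P i l) (n : ℕ) (i : V) :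
    0 ≤ survivalProb P j n i := by
  induction n generalizing i with
  | zero => simp [survivalProb]
  | succ n ih =>
    rw [survivalProb]
    exact Finset.sum_nonneg fun l _ => mul_nonneg (hP i l) (ih l)

lemma firstPassageProb_nonneg (hP : ∀ i l, 0 ≤ P i l) (n : ℕ) (i : V) :
    0 ≤ firstPassageProb P j n i := by
  induction n generalizing i with
  | zero => simp [firstPassageProb]
  | succ n ih =>
    cases n with
    | zero => simpa [firstPassageProb] using hP i j
    | succ n =>
      rw [firstPassageProb]
      exact Finset.sum_nonneg fun l _ => mul_nonneg (hP i l) (ih l)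

lemma meanFirstPassageTime_nonneg (hP : ∀ i l, 0 ≤ P i l) (i : V) :
    0 ≤ meanFirstPassageTime P i j :=
  tsum_nonneg fun n => mul_nonneg n.cast_nonneg (firstPassageProb_nonneg hP n i)

lemma firstPassageProb_succ_eq_sub (hP1 : ∀ i, ∑ l, P i l = 1) (n : ℕ) (i : V) :
    firstPassageProb P j (n + 1) i = survivalProb P j n i - survivalProb P j (n + 1) i := by
  induction n generalizing i with
  | zero =>
    have h := Finset.sum_filter_add_sum_filter_not Finset.univ (fun l => l ≠ j) (fun l => P i l)
    simp only [not_not, Finset.sum_filter, Finset.sum_ite_eq', Finset.mem_univ, if_true,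
      hP1 i] at h
    simp only [firstPassageProb, survivalProb, mul_one, Finset.sum_filter]
    linarith
  | succ n ih =>
    rw [firstPassageProb, survivalProb, survivalProb, ← Finset.sum_sub_distrib]
    exact Finset.sum_congr rfl fun l _ => by rw [ih l]; rw [survivalProb]; ring

/-- The expected passage time is the least nonnegative solution of the first step system. Bounding
partial sums by any solution gives summability without estimating decay rates. -/
lemma sum_survivalProb_le (hP : ∀ i l, 0 ≤ P i l) {h : V → ℝ} (h0 : ∀ i, 0 ≤ h i)
    (hh : ∀ i, h i = 1 + ∑ l ∈ Finset.univ.filter (fun l => l ≠ j), P i l * h l)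
    (N : ℕ) (i : V) : ∑ n ∈ Finset.range N, survivalProb P j n i ≤ h i := by
  induction N generalizing i with
  | zero => simpa using h0 i
  | succ N ih =>
    rw [Finset.sum_range_succ', hh i, add_comm]
    simp only [survivalProb]
    rw [Finset.sum_comm]
    gcongr with l hl
    rw [← Finset.mul_sum]
    exact mul_le_mul_of_nonneg_left (ih l) (hP i l)

lemma sum_mul_firstPassageProb_eq (hP1 : ∀ i, ∑ l, P i l = 1) (N : ℕ) (i : V) :
    ∑ n ∈ Finset.range (N + 1), (n : ℝ) * firstPassageProb P j n i =
      ∑ n ∈ Finset.range N, survivalProb P j n i - N * survivalProb P j N i := by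
  induction N with
  | zero => simp
  | succ N ih =>
    rw [Finset.sum_range_succ, ih, Finset.sum_range_succ, firstPassageProb_succ_eq_sub hP1]
    push_cast
    ring

/-- First step analysis for the mean first passage time, provided that the system of equations
has some nonnegative solution. -/
theorem meanFirstPassageTime_eq_one_add (hP : ∀ i l, 0 ≤ P i l) (hP1 : ∀ i, ∑ l, P i l = 1)
    {h : V → ℝ} (h0 : ∀ i, 0 ≤ h i)
    (hh : ∀ i, h i = 1 + ∑ l ∈ Finset.univ.filter (fun l => l ≠ j), P i l * h l) (i : V) :
    meanFirstPassageTime P i j =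
      1 + ∑ l ∈ Finset.univ.filter (fun l => l ≠ j), P i l * meanFirstPassageTime P l j := by
  have hs : ∀ i, Summable fun n => survivalProb P j n i := fun i =>
    summable_of_sum_range_le (fun n => survivalProb_nonneg hP n i)
      fun N => sum_survivalProb_le hP h0 hh N i
  -- The partial sums telescope to one minus the survival probability, and a summable sequence tends
  -- to zero: `j` is reached almost surely.
  have hf : ∀ i, HasSum (fun n => firstPassageProb P j (n + 1) i) 1 := by
    intro i
    rw [hasSum_iff_tendsto_nat_of_nonneg fun n => firstPassageProb_nonneg hP (n + 1) i]
    have : ∀ N, ∑ n ∈ Finset.range N, firstPassageProb P j (n + 1) i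
        = 1 - survivalProb P j N i := by
      intro N
      simp only [firstPassageProb_succ_eq_sub hP1]
      rw [Finset.sum_range_sub']
      simp [survivalProb]
    simp only [this]
    simpa using (hs i).tendsto_atTop_zero.const_sub 1
  have hm : ∀ i, Summable fun n : ℕ => (n : ℝ) * firstPassageProb P j n i := by
    intro i
    refine summable_of_sum_range_le (c := h i)
      (fun n => mul_nonneg n.cast_nonneg (firstPassageProb_nonneg hP n i)) fun N => ?_
    calc _ ≤ ∑ n ∈ Finset.range (N + 1), (n : ℝ) * firstPassageProb P j n i := by
          rw [Finset.sum_range_succ]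
          exact le_add_of_nonneg_right
            (mul_nonneg N.cast_nonneg (firstPassageProb_nonneg hP N i))
      _ ≤ ∑ n ∈ Finset.range N, survivalProb P j n i := by
          rw [sum_mul_firstPassageProb_eq hP1]
          exact sub_le_self _ (mul_nonneg N.cast_nonneg (survivalProb_nonneg hP N i))
      _ ≤ h i := sum_survivalProb_le hP h0 hh N i
  have hm' : ∀ i, HasSum (fun n : ℕ => ((n + 1 : ℕ) : ℝ) * firstPassageProb P j (n + 1) i)
      (meanFirstPassageTime P i j) := by
    intro i
    have := (hasSum_nat_add_iff' 1).2 (hm i).hasSum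
    simpa [meanFirstPassageTime] using this
  -- Split the weight n + 1 into 1 and n: the first part has total mass 1, and the second is shifted
  -- by the recursion into means from the next state.
  have h2 : HasSum (fun n : ℕ => (n : ℝ) * firstPassageProb P j (n + 1) i)
      (∑ l ∈ Finset.univ.filter (fun l => l ≠ j), P i l * meanFirstPassageTime P l j) := by
    rw [← hasSum_nat_add_iff' 1]
    have := hasSum_sum (s := Finset.univ.filter (fun l => l ≠ j))
      fun l _ => (hm' l).mul_left (P i l)
    simp only [Finset.range_one, Finset.sum_singleton, Nat.cast_zero, zero_mul, sub_zero]
    refine this.congr_fun ?_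
    intro n
    rw [firstPassageProb, Finset.mul_sum]
    exact Finset.sum_congr rfl fun l _ => by ring
  refine (hm' i).unique ?_
  refine ((hf i).add h2).congr_fun ?_
  intro n
  push_cast
  ring

end FirstPassage

/-! ### Hitting times and the Laplacian -/

namespace SimpleGraph

section Resistance

open Classical

variable {V : Type*} [Fintype V]

/-- The Laplacian of a graph as a linear operator on real functions on the vertices. -/
noncomputable def lap (G : SimpleGraph V) : (V → ℝ) →ₗ[ℝ] (V → ℝ) :=
  Matrix.toLin' (G.lapMatrix ℝ)

/-- The sum of all degrees, as a real number. -/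
noncomputable def totalDegree (G : SimpleGraph V) : ℝ := ∑ i, (G.degree i : ℝ)

variable {G : SimpleGraph V}

lemma degree_eq_sum (G : SimpleGraph V) (i : V) :
    (G.degree i : ℝ) = ∑ j, if G.Adj i j then 1 else 0 := by
  rw [degree_eq_sum_if_adj]

lemma lap_apply (G : SimpleGraph V) (u : V → ℝ) (i : V) :
    G.lap u i = ∑ j, if G.Adj i j then u i - u j else 0 := by
  rw [lap, Matrix.toLin'_apply, lapMatrix_mulVec_apply, degree_eq_sum, Finset.sum_mul,
    ← Finset.sum_filter_add_sum_filter_not Finset.univ (fun j => G.Adj i j)]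
  have h : G.neighborFinset i = Finset.univ.filter (fun j => G.Adj i j) := by ext; simp
  rw [h, Finset.sum_filter, Finset.sum_filter, Finset.sum_filter, ← Finset.sum_add_distrib,
    ← Finset.sum_sub_distrib]
  refine Finset.sum_congr rfl fun j _ => ?_
  by_cases hj : G.Adj i j <;> simp [hj]

lemma sum_mul_lap_comm (G : SimpleGraph V) (u w : V → ℝ) :
    ∑ i, w i * G.lap u i = ∑ i, u i * G.lap w i := by
  change w ⬝ᵥ (Matrix.toLin' (G.lapMatrix ℝ) u) = u ⬝ᵥ (Matrix.toLin' (G.lapMatrix ℝ) w)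
  rw [Matrix.toLin'_apply, Matrix.toLin'_apply, Matrix.dotProduct_mulVec,
    ← Matrix.mulVec_transpose, (G.isSymm_lapMatrix (R := ℝ)).eq, dotProduct_comm]

lemma lap_const (G : SimpleGraph V) (c : ℝ) : G.lap (fun _ => c) = 0 := by
  ext i
  simp [lap_apply]

lemma sum_lap (G : SimpleGraph V) (u : V → ℝ) : ∑ i, G.lap u i = 0 := by
  have h := sum_mul_lap_comm G u (fun _ => 1)
  simpa [lap_const] using h

lemma Connected.eq_of_lap_eq_zero (hG : G.Connected) {u : V → ℝ} (hu : G.lap u = 0) (i j : V) :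
    u i = u j :=
  (lapMatrix_mulVec_eq_zero_iff_forall_reachable G).1
    (by rwa [lap, Matrix.toLin'_apply] at hu) i j (hG.preconnected i j)

/-- The equation satisfied by the hitting times of a vertex `j`. -/
lemma Connected.exists_lap_eq_degree_sub (hG : G.Connected) (j : V) :
    ∃ h : V → ℝ, h j = 0 ∧
      ∀ i, G.lap h i = G.degree i - if i = j then G.totalDegree else 0 := by
  -- The Laplacian kills only constants, so adding the rank-one term at `j` makes it injective,
  -- hence surjective. The entries of `A u` sum to `u j`, which identifies the multiple of the
  -- indicator as the total degree.
  let A : (V → ℝ) →ₗ[ℝ] (V → ℝ) :=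
    G.lap + (LinearMap.proj j).smulRight (Pi.single j (1 : ℝ))
  have hA : ∀ u i, A u i = G.lap u i + if i = j then u j else 0 := by
    intro u i
    by_cases h : i = j <;> simp [A, h]
  have hsum : ∀ u, ∑ i, A u i = u j := by
    intro u
    simp [hA, Finset.sum_add_distrib, sum_lap]
  have hinj : Function.Injective A := by
    rw [injective_iff_map_eq_zero]
    intro u hu
    have hj : u j = 0 := by rw [← hsum u, hu]; simp
    have hl : G.lap u = 0 := by
      ext i
      have := congrFun hu i
      rw [hA, hj] at this
      simpa using this
    ext i
    rw [hG.eq_of_lap_eq_zero hl i j, hj]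
    rfl
  obtain ⟨h, hh⟩ := (LinearMap.injective_iff_surjective.1 hinj) fun i => (G.degree i : ℝ)
  have hj : h j = G.totalDegree := by rw [← hsum h, hh]; rfl
  refine ⟨h - fun _ => h j, by simp, fun i => ?_⟩
  rw [map_sub, lap_const, sub_zero]
  have := congrFun hh i
  rw [hA, hj] at this
  linarith

lemma Connected.degree_pos' (hG : G.Connected) [Nontrivial V] (i : V) :
    (0 : ℝ) < G.degree i := by
  exact_mod_cast hG.preconnected.degree_pos_of_nontrivial i

lemma walkMatrix_nonneg (G : SimpleGraph V) (i j : V) : 0 ≤ G.walkMatrix i j := by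
  unfold walkMatrix
  split_ifs <;> positivity

lemma Connected.sum_walkMatrix (hG : G.Connected) [Nontrivial V] (i : V) :
    ∑ j, G.walkMatrix i j = 1 := by
  have h := hG.degree_pos' i
  have h2 : ∑ j, G.walkMatrix i j = (∑ j, if G.Adj i j then (1 : ℝ) else 0) / G.degree i := by
    rw [Finset.sum_div]
    refine Finset.sum_congr rfl fun j _ => ?_
    unfold walkMatrix
    split_ifs <;> simp
  rw [h2, ← degree_eq_sum, div_self h.ne']

lemma Connected.lap_eq (hG : G.Connected) [Nontrivial V] (u : V → ℝ) (i : V) :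
    G.lap u i = G.degree i * (u i - ∑ l, G.walkMatrix i l * u l) := by
  have h := hG.degree_pos' i
  rw [mul_sub, Finset.mul_sum, lap_apply, degree_eq_sum, Finset.sum_mul,
    ← Finset.sum_sub_distrib]
  refine Finset.sum_congr rfl fun j _ => ?_
  rw [← degree_eq_sum]
  unfold walkMatrix
  split_ifs
  · field_simp
  · simp

lemma sum_filter_ne_eq {u : V → ℝ} {j : V} (P : V → ℝ) (hj : u j = 0) :
    ∑ l ∈ Finset.univ.filter (fun l => l ≠ j), P l * u l = ∑ l, P l * u l := by
  rw [Finset.sum_filter]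
  refine Finset.sum_congr rfl fun l _ => ?_
  by_cases hl : l = j <;> simp [hl, hj]

/-- The expected time for the walk started at `i` to visit `j`, time `0` included. -/
noncomputable def hittingTime (G : SimpleGraph V) (j i : V) : ℝ :=
  if i = j then 0 else meanFirstPassageTime G.walkMatrix i j

lemma hittingTime_self (G : SimpleGraph V) (j : V) : G.hittingTime j j = 0 := by
  simp [hittingTime]

lemma hittingTime_nonneg (G : SimpleGraph V) (j i : V) : 0 ≤ G.hittingTime j i := by
  unfold hittingTime
  split_ifs
  · exact le_rfl
  · exact meanFirstPassageTime_nonneg G.walkMatrix_nonneg i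

/-- Away from `j` this is first step analysis times the degree; at `j` the value is forced because a
Laplacian sums to zero. -/
theorem Connected.lap_hittingTime (hG : G.Connected) (j i : V) :
    G.lap (G.hittingTime j) i = G.degree i - if i = j then G.totalDegree else 0 := by
  rcases subsingleton_or_nontrivial V with hV | hV
  · have hd : ∀ i, (G.degree i : ℝ) = 0 := by
      intro i
      rw [degree_eq_sum]
      refine Finset.sum_eq_zero fun l _ => ?_
      rw [Subsingleton.elim l i]
      simp
    rw [lap_apply]
    simp only [totalDegree, hd]
    simp only [Subsingleton.elim _ i]
    simp
  obtain ⟨h, hj, hh⟩ := hG.exists_lap_eq_degree_sub j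
  have hstep : ∀ i, i ≠ j → h i = 1 + ∑ l, G.walkMatrix i l * h l := by
    intro i hi
    have h1 := hh i
    rw [hG.lap_eq, if_neg hi, sub_zero] at h1
    have h2 := hG.degree_pos' i
    have h3 : h i - ∑ l, G.walkMatrix i l * h l = 1 := by
      field_simp at h1
      linarith
    linarith
  -- Minimum principle: at a minimizer other than `j`, `h` would exceed the average of its
  -- neighbours by 1.
  have h0 : ∀ i, 0 ≤ h i := by
    obtain ⟨i, hi⟩ := Finite.exists_min h
    have hij : i = j := by
      by_contra hne
      have h1 : h i ≤ ∑ l, G.walkMatrix i l * h l := by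
        calc h i = ∑ l, G.walkMatrix i l * h i := by rw [← Finset.sum_mul, hG.sum_walkMatrix, one_mul]
          _ ≤ _ := Finset.sum_le_sum fun l _ =>
            mul_le_mul_of_nonneg_left (hi l) (G.walkMatrix_nonneg i l)
      have h2 := hstep i hne
      linarith
    intro l
    rw [← hj, ← hij]
    exact hi l
  -- The first passage system at `j` asks for the return time rather than 0; `h'` agrees with `h`
  -- elsewhere and corrects this value.
  let h' : V → ℝ := fun i => 1 + ∑ l, G.walkMatrix i l * h l
  have hm := meanFirstPassageTime_eq_one_add (j := j) (h := h') G.walkMatrix_nonneg hG.sum_walkMatrix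
    (fun i => add_nonneg zero_le_one
      (Finset.sum_nonneg fun l _ => mul_nonneg (G.walkMatrix_nonneg i l) (h0 l)))
    (fun i => by
      simp only [h']
      rw [← sum_filter_ne_eq (fun l => G.walkMatrix i l) hj]
      congr 1
      refine Finset.sum_congr rfl fun l hl => ?_
      rw [hstep l (Finset.mem_filter.1 hl).2])
  have hoff : ∀ i, i ≠ j → G.lap (G.hittingTime j) i = G.degree i := by
    intro i hi
    have h1 : G.hittingTime j i = 1 + ∑ l, G.walkMatrix i l * G.hittingTime j l := by
      rw [← sum_filter_ne_eq _ (G.hittingTime_self j)]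
      conv_lhs => rw [hittingTime, if_neg hi, hm i]
      congr 1
      refine Finset.sum_congr rfl fun l hl => ?_
      rw [hittingTime, if_neg (Finset.mem_filter.1 hl).2]
    rw [hG.lap_eq, h1]
    ring
  by_cases hi : i = j
  · subst hi
    have h1 := sum_lap G (G.hittingTime i)
    rw [← Finset.add_sum_erase _ _ (Finset.mem_univ i),
      Finset.sum_congr rfl fun l hl => hoff l (Finset.ne_of_mem_erase hl)] at h1
    have h2 : G.totalDegree = G.degree i + ∑ l ∈ Finset.univ.erase i, (G.degree l : ℝ) := by
      rw [totalDegree, Finset.add_sum_erase _ (fun l => (G.degree l : ℝ)) (Finset.mem_univ i)]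
    rw [if_pos rfl, h2]
    linarith
  · rw [hoff i hi, if_neg hi, sub_zero]

end Resistance

end SimpleGraph

/-! ### Kemeny's constant and accessibility through resistances -/

namespace SimpleGraph

section Resistance

open Classical

variable {V : Type*} [Fintype V] {G : SimpleGraph V}

/-- `R` behaves like the matrix of effective resistances of `G`: it vanishes on the diagonal and,
up to a function `t` that does not depend on `q`, the Laplacian of `R · q` is `-2` times the
indicator of `q`. -/
structure IsResistanceKernel (G : SimpleGraph V) (R : V → V → ℝ) (t : V → ℝ) : Prop where
  diag : ∀ q, R q q = 0
  lap_eq : ∀ q p, G.lap (fun p => R p q) p = t p - if p = q then 2 else 0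

/-- The sum of `R p q` over pairs of vertices weighted by their degrees. -/
noncomputable def degreeEnergy (G : SimpleGraph V) (R : V → V → ℝ) : ℝ :=
  ∑ p, ∑ q, (G.degree p : ℝ) * G.degree q * R p q

lemma totalDegree_eq (G : SimpleGraph V) : G.totalDegree = 2 * (G.edgeFinset.card : ℝ) := by
  rw [totalDegree]
  exact_mod_cast G.sum_degrees_eq_twice_card_edges

lemma walkStationary_eq (G : SimpleGraph V) (i : V) :
    G.walkStationary i = G.degree i / G.totalDegree := by
  rw [walkStationary, totalDegree_eq]

lemma totalDegree_nonneg (G : SimpleGraph V) : 0 ≤ G.totalDegree :=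
  Finset.sum_nonneg fun _ _ => Nat.cast_nonneg _

lemma Connected.totalDegree_pos (hG : G.Connected) [Nontrivial V] : 0 < G.totalDegree :=
  have := hG.nonempty
  Finset.sum_pos (fun i _ => hG.degree_pos' i) Finset.univ_nonempty

lemma accessibilityIndex_eq (G : SimpleGraph V) (q : V) :
    G.accessibilityIndex q = (∑ p, (G.degree p : ℝ) * G.hittingTime q p) / G.totalDegree := by
  rw [accessibilityIndex, Finset.sum_filter, Finset.sum_div]
  refine Finset.sum_congr rfl fun p _ => ?_
  rw [walkStationary_eq, hittingTime]
  by_cases h : p = q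
  · simp [h]
  · rw [if_pos h, if_neg h]
    ring

lemma kemenyConstant_eq (G : SimpleGraph V) :
    G.kemenyConstant =
      (∑ p, ∑ q, (G.degree p : ℝ) * G.degree q * G.hittingTime q p) / G.totalDegree ^ 2 := by
  rw [kemenyConstant, Finset.sum_div]
  refine Finset.sum_congr rfl fun p _ => ?_
  rw [Finset.sum_filter, Finset.sum_div]
  refine Finset.sum_congr rfl fun q _ => ?_
  rw [walkStationary_eq, walkStationary_eq, hittingTime]
  by_cases h : q = p
  · simp [h]
  · rw [if_pos h, if_neg (Ne.symm h)]
    ring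

/-- As functions of `p` both sides have the same Laplacian, `t` cancelling because the degrees sum
to `G.totalDegree`; the value at `p = q` fixes the constant. -/
theorem IsResistanceKernel.hittingTime_eq {R : V → V → ℝ} {t : V → ℝ}
    (hR : G.IsResistanceKernel R t) (hG : G.Connected) (q p : V) :
    G.hittingTime q p = G.totalDegree / 2 * R p q - (∑ l, G.degree l * R p l) / 2
      + (∑ l, G.degree l * R q l) / 2 := by
  let u : V → ℝ := G.hittingTime q - (G.totalDegree / 2) • (fun p => R p q)
    + (1 / 2 : ℝ) • ∑ l, (G.degree l : ℝ) • (fun p => R p l)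
  have hu : G.lap u = 0 := by
    ext p
    simp only [u, map_add, map_sub, map_smul, map_sum, Pi.add_apply, Pi.sub_apply, Pi.smul_apply,
      Finset.sum_apply, smul_eq_mul, hG.lap_hittingTime, hR.lap_eq, mul_sub,
      Finset.sum_sub_distrib, ← Finset.sum_mul, Pi.zero_apply]
    change _ - _ - _ + (_ * (G.totalDegree * _) - _) = _
    simp only [mul_ite, mul_zero, Finset.sum_ite_eq, Finset.mem_univ, if_true]
    split_ifs <;> ring
  have h := hG.eq_of_lap_eq_zero hu p q
  simp only [u, Pi.add_apply, Pi.sub_apply, Pi.smul_apply, Finset.sum_apply, smul_eq_mul,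
    hittingTime_self, hR.diag] at h
  linarith

/-- Summed against both degrees, the two correction terms in `hittingTime_eq` cancel. -/
theorem IsResistanceKernel.kemenyConstant_eq {R : V → V → ℝ} {t : V → ℝ}
    (hR : G.IsResistanceKernel R t) (hG : G.Connected) :
    G.kemenyConstant = G.degreeEnergy R / (2 * G.totalDegree) := by
  -- For total degree zero both sides are quotients by zero, hence 0.
  rcases eq_or_ne G.totalDegree 0 with h0 | h0
  · rw [SimpleGraph.kemenyConstant_eq, h0]
    simp
  have h1 : ∑ p, ∑ q, (G.degree p : ℝ) * G.degree q * G.hittingTime q p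
      = G.totalDegree / 2 * G.degreeEnergy R := by
    have h2 : ∀ p q, (G.degree p : ℝ) * G.degree q * G.hittingTime q p =
        G.totalDegree / 2 * (G.degree p * G.degree q * R p q)
        - G.degree q * ((G.degree p * ∑ l, G.degree l * R p l) / 2)
        + G.degree p * ((G.degree q * ∑ l, G.degree l * R q l) / 2) := by
      intro p q
      rw [hR.hittingTime_eq hG]
      ring
    simp only [h2, Finset.sum_add_distrib, Finset.sum_sub_distrib, ← Finset.mul_sum,
      ← Finset.sum_mul]
    rw [degreeEnergy]
    ring
  rw [SimpleGraph.kemenyConstant_eq, h1]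
  field_simp

/-- Only the first term depends on `q`; the second is Kemeny's constant. -/
theorem IsResistanceKernel.accessibilityIndex_eq {R : V → V → ℝ} {t : V → ℝ}
    (hR : G.IsResistanceKernel R t) (hsymm : ∀ p q, R p q = R q p) (hG : G.Connected)
    (h0 : G.totalDegree ≠ 0) (q : V) :
    G.accessibilityIndex q =
      ∑ p, G.degree p * R p q - G.degreeEnergy R / (2 * G.totalDegree) := by
  have h1 : ∑ p, (G.degree p : ℝ) * G.hittingTime q p
      = G.totalDegree * (∑ p, G.degree p * R p q) - G.degreeEnergy R / 2 := by
    have h2 : ∀ p, (G.degree p : ℝ) * G.hittingTime q p =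
        G.totalDegree / 2 * (G.degree p * R p q)
        - (∑ l, G.degree p * G.degree l * R p l) / 2
        + G.degree p * ((∑ l, G.degree l * R l q) / 2) := by
      intro p
      rw [hR.hittingTime_eq hG]
      simp only [hsymm q, mul_assoc, ← Finset.mul_sum]
      ring
    simp only [h2, Finset.sum_add_distrib, Finset.sum_sub_distrib, ← Finset.mul_sum,
      ← Finset.sum_mul, ← Finset.sum_div]
    rw [degreeEnergy]
    change _ - _ + G.totalDegree * _ = _
    ring
  rw [SimpleGraph.accessibilityIndex_eq, h1]
  field_simp

/-- The effective resistance between two vertices, defined through the commute time. -/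
noncomputable def effectiveResistance (G : SimpleGraph V) (p q : V) : ℝ :=
  (G.hittingTime q p + G.hittingTime p q) / G.totalDegree

lemma effectiveResistance_comm (G : SimpleGraph V) (p q : V) :
    G.effectiveResistance p q = G.effectiveResistance q p := by
  rw [effectiveResistance, effectiveResistance, add_comm]

lemma effectiveResistance_nonneg (G : SimpleGraph V) (p q : V) :
    0 ≤ G.effectiveResistance p q :=
  div_nonneg (add_nonneg (G.hittingTime_nonneg q p) (G.hittingTime_nonneg p q))
    G.totalDegree_nonneg

/-- The commute time contains a hitting time whose target varies with `p`. Symmetry of the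
Laplacian, applied to two hitting time functions (`hA`), trades it for the hitting time of the fixed
target `q` plus a difference of values of `A`. -/
theorem Connected.exists_isResistanceKernel (hG : G.Connected) :
    ∃ t, G.IsResistanceKernel G.effectiveResistance t := by
  rcases subsingleton_or_nontrivial V with hV | hV
  -- Here `p = q` always and the Laplacian vanishes, which forces `t = 2`.
  · refine ⟨fun _ => 2, fun q => by simp [effectiveResistance, hittingTime_self], fun q p => ?_⟩
    rw [lap_apply]
    simp [Subsingleton.elim _ p]
  have h0 := hG.totalDegree_pos.ne'
  let A : V → ℝ := fun p => ∑ i, G.degree i * G.hittingTime p i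
  have hA : ∀ p q, A p - G.totalDegree * G.hittingTime p q
      = A q - G.totalDegree * G.hittingTime q p := by
    intro p q
    have h := sum_mul_lap_comm G (G.hittingTime q) (G.hittingTime p)
    simp only [hG.lap_hittingTime, mul_sub, Finset.sum_sub_distrib, mul_ite, mul_zero,
      Finset.sum_ite_eq', Finset.mem_univ, if_true] at h
    simp only [A, mul_comm (G.degree _ : ℝ), mul_comm G.totalDegree]
    exact h
  refine ⟨fun p => 2 * G.degree p / G.totalDegree + G.lap A p / G.totalDegree ^ 2,
    fun q => by simp [effectiveResistance, hittingTime_self], fun q p => ?_⟩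
  have h : (fun p => G.effectiveResistance p q) =
      (2 / G.totalDegree) • G.hittingTime q
        + (1 / G.totalDegree ^ 2) • (A - fun _ => A q) := by
    ext p
    have := hA p q
    simp only [effectiveResistance, Pi.add_apply, Pi.smul_apply, Pi.sub_apply, smul_eq_mul]
    field_simp
    linarith
  rw [h]
  simp only [map_add, map_smul, map_sub, lap_const, Pi.add_apply, Pi.smul_apply, Pi.sub_apply,
    Pi.zero_apply, smul_eq_mul, hG.lap_hittingTime]
  split_ifs
  · field_simp
    ring
  · field_simp
    ring

/-- A vertex of minimal accessibility index minimizes the degree-weighted sum of resistances. -/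
theorem Connected.sum_degree_mul_effectiveResistance_le (hG : G.Connected) {v w : V}
    (h : G.accessibilityIndex v ≤ G.accessibilityIndex w) :
    ∑ p, G.degree p * G.effectiveResistance p v ≤ ∑ p, G.degree p * G.effectiveResistance p w := by
  rcases subsingleton_or_nontrivial V with hV | hV
  · rw [Subsingleton.elim v w]
  obtain ⟨t, ht⟩ := hG.exists_isResistanceKernel
  have h0 := hG.totalDegree_pos.ne'
  rw [ht.accessibilityIndex_eq G.effectiveResistance_comm hG h0,
    ht.accessibilityIndex_eq G.effectiveResistance_comm hG h0] at h
  linarith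

end Resistance

end SimpleGraph

/-! ### Distance sums in trees -/

namespace SimpleGraph

section Tree

open Classical

variable {ι : Type*} {T : SimpleGraph ι}

/-- A neighbour of `i` that is closer to `j` than `i` is. -/
noncomputable def towards (T : SimpleGraph ι) (i j : ι) : ι :=
  if h : ∃ l, T.Adj i l ∧ T.dist i j = T.dist l j + 1 then h.choose else i

lemma Connected.towards_spec (hT : T.Connected) {i j : ι} (hij : i ≠ j) :
    T.Adj i (T.towards i j) ∧ T.dist i j = T.dist (T.towards i j) j + 1 := by
  have h : ∃ l, T.Adj i l ∧ T.dist i j = T.dist l j + 1 := by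
    obtain ⟨p, hp⟩ := hT.exists_walk_length_eq_dist i j
    cases p with
    | nil => exact absurd rfl hij
    | @cons _ l _ hil q =>
      refine ⟨l, hil, le_antisymm ?_ ?_⟩
      · obtain ⟨q', hq'⟩ := hT.exists_walk_length_eq_dist l j
        rw [← hq']
        exact T.dist_le (Walk.cons hil q')
      · rw [← hp, Walk.length_cons]
        exact Nat.add_le_add_right (T.dist_le q) 1
  rw [towards, dif_pos h]
  exact h.choose_spec

/-- Both neighbours extend to shortest paths from `i` to `j`, and a tree has only one path. -/
lemma IsTree.eq_of_dist_eq_add_one (hT : T.IsTree) {i j l l' : ι} (hl : T.Adj i l)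
    (hl' : T.Adj i l') (h : T.dist i j = T.dist l j + 1) (h' : T.dist i j = T.dist l' j + 1) :
    l = l' := by
  obtain ⟨q, hq⟩ := hT.connected.exists_walk_length_eq_dist l j
  obtain ⟨q', hq'⟩ := hT.connected.exists_walk_length_eq_dist l' j
  have hp : (Walk.cons hl q).IsPath := Walk.isPath_of_length_eq_dist _ (by simp [hq, h])
  have hp' : (Walk.cons hl' q').IsPath := Walk.isPath_of_length_eq_dist _ (by simp [hq', h'])
  have := congrArg (fun w => w.1.snd) ((isAcyclic_iff_subsingleton_path.1 hT.isAcyclic i j).elim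
    ⟨_, hp⟩ ⟨_, hp'⟩)
  simpa using this

lemma IsTree.eq_towards (hT : T.IsTree) {i j l : ι} (hl : T.Adj i l)
    (h : T.dist i j = T.dist l j + 1) : i ≠ j ∧ l = T.towards i j := by
  have hij : i ≠ j := by
    rintro rfl
    simp at h
  obtain ⟨h1, h2⟩ := hT.connected.towards_spec hij
  exact ⟨hij, hT.eq_of_dist_eq_add_one hl h1 h h2⟩

lemma IsTree.eq_towards_or (hT : T.IsTree) {i l : ι} (hl : T.Adj i l) (j : ι) :
    (i ≠ j ∧ l = T.towards i j) ∨ (l ≠ j ∧ i = T.towards l j) := by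
  have h := hT.dist_eq_dist_add_one_of_adj j hl
  rw [T.dist_comm (u := j), T.dist_comm (u := j)] at h
  rcases h with h | h
  · exact Or.inl (hT.eq_towards hl h)
  · exact Or.inr (hT.eq_towards hl.symm h)

lemma IsTree.not_eq_towards_and (hT : T.IsTree) {i l j : ι} (h : i ≠ j ∧ l = T.towards i j) :
    ¬ (l ≠ j ∧ i = T.towards l j) := by
  rintro ⟨h1, h2⟩
  have h3 := (hT.connected.towards_spec h.1).2
  have h4 := (hT.connected.towards_spec h1).2
  rw [← h.2] at h3
  rw [← h2] at h4
  omega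

variable [Fintype ι]

/-- Root the tree at `j`: each edge joins exactly one `i ≠ j` to its parent `T.towards i j`. -/
lemma IsTree.sum_adj (hT : T.IsTree) (j : ι) (f : ι → ι → ℝ) :
    ∑ i, ∑ l, (if T.Adj i l then f i l else 0) =
      ∑ i, if i ≠ j then f i (T.towards i j) + f (T.towards i j) i else 0 := by
  have h : ∀ i l, (if T.Adj i l then f i l else 0) =
      (if l = T.towards i j then (if i ≠ j then f i l else 0) else 0)
      + (if i = T.towards l j then (if l ≠ j then f i l else 0) else 0) := by
    intro i l
    by_cases hil : T.Adj i l
    · rcases hT.eq_towards_or hil j with h | h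
      · have h' := hT.not_eq_towards_and h
        rw [if_pos hil, if_pos h.2, if_pos h.1]
        by_cases h2 : i = T.towards l j
        · have : l = j := by tauto
          simp [this]
        · simp [h2]
      · have h' := fun h' => hT.not_eq_towards_and h' h
        rw [if_pos hil, if_pos h.2, if_pos h.1]
        by_cases h2 : l = T.towards i j
        · have : i = j := by tauto
          simp [this]
        · simp [h2]
    · have h1 : i ≠ j → l ≠ T.towards i j := by
        intro h1 h2
        exact hil (h2 ▸ (hT.connected.towards_spec h1).1)
      have h2 : l ≠ j → i ≠ T.towards l j := by
        intro h1 h2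
        have h3 := (hT.connected.towards_spec h1).1
        rw [← h2] at h3
        exact hil h3.symm
      have e1 : (if l = T.towards i j then (if i ≠ j then f i l else 0) else 0) = 0 := by
        split_ifs with h3 h4
        · exact absurd h3 (h1 h4)
        · rfl
        · rfl
      have e2 : (if i = T.towards l j then (if l ≠ j then f i l else 0) else 0) = 0 := by
        split_ifs with h3 h4
        · exact absurd h3 (h2 h4)
        · rfl
        · rfl
      rw [if_neg hil, e1, e2, add_zero]
  simp only [h, Finset.sum_add_distrib]
  conv_lhs => arg 2; rw [Finset.sum_comm]
  simp only [Finset.sum_ite_eq', Finset.mem_univ, if_true]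
  rw [← Finset.sum_add_distrib]
  refine Finset.sum_congr rfl fun i _ => ?_
  split_ifs <;> simp

lemma sum_sum_ite_adj (T : SimpleGraph ι) (f : ι → ℝ) :
    ∑ i, ∑ l, (if T.Adj i l then f i else 0) = ∑ i, T.degree i * f i := by
  refine Finset.sum_congr rfl fun i _ => ?_
  rw [degree_eq_sum, Finset.sum_mul]
  exact Finset.sum_congr rfl fun l _ => by split_ifs <;> simp

lemma sum_ite_ne (j : ι) (c : ℝ) :
    ∑ i : ι, (if i ≠ j then c else 0) = (Fintype.card ι - 1) * c := by
  have : ∀ i : ι, (if i ≠ j then c else 0) = c - if i = j then c else 0 := by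
    intro i
    by_cases h : i = j <;> simp [h]
  simp only [this, Finset.sum_sub_distrib, Finset.sum_ite_eq', Finset.mem_univ, if_true]
  simp [sub_mul]

lemma IsTree.totalDegree_eq (hT : T.IsTree) : T.totalDegree = 2 * (Fintype.card ι - 1) := by
  obtain ⟨j⟩ := hT.connected.nonempty
  have h := hT.sum_adj j (fun _ _ => 1)
  rw [sum_sum_ite_adj, sum_ite_ne] at h
  simp only [mul_one] at h
  rw [totalDegree, h]
  ring

/-- With the tree rooted at `j`, the edge from `i` to its parent contributes the distances of its
two ends, which differ by 1. -/
lemma IsTree.sum_degree_mul_dist (hT : T.IsTree) (j : ι) :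
    ∑ i, (T.degree i : ℝ) * T.dist i j = 2 * ∑ i, (T.dist i j : ℝ) - (Fintype.card ι - 1) := by
  have h : ∀ i, (if i ≠ j then (T.dist i j : ℝ) + T.dist (T.towards i j) j else 0) =
      2 * T.dist i j - if i ≠ j then 1 else 0 := by
    intro i
    by_cases hi : i = j
    · simp [hi]
    · rw [if_pos hi, if_pos hi, (hT.connected.towards_spec hi).2]
      push_cast
      ring
  rw [← sum_sum_ite_adj, hT.sum_adj j (fun i _ => (T.dist i j : ℝ)),
    Finset.sum_congr rfl fun i _ => h i, Finset.sum_sub_distrib, sum_ite_ne, Finset.mul_sum,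
    mul_one]

/-- The sum of all distances, over ordered pairs of vertices. -/
noncomputable def totalDist (T : SimpleGraph ι) : ℝ := ∑ i, ∑ j, (T.dist i j : ℝ)

/-- Removing the degree factors one at a time by `sum_degree_mul_dist` leaves the total distance as
the only trace of the tree's shape. -/
lemma IsTree.sum_sum_mul_dist (hT : T.IsTree) (c : ℝ) :
    ∑ i, ∑ j, (c + T.degree i) * (c + T.degree j) * (T.dist i j : ℝ) =
      (c + 2) ^ 2 * T.totalDist
        - (2 * c + 2) * Fintype.card ι * (Fintype.card ι - 1) - 2 * (Fintype.card ι - 1) ^ 2 := by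
  set k : ℝ := (Fintype.card ι : ℝ)
  have h1 : ∀ j, ∑ i, (c + T.degree i) * (c + T.degree j) * (T.dist i j : ℝ) =
      (c + T.degree j) * ((c + 2) * ∑ i, (T.dist i j : ℝ) - (k - 1)) := by
    intro j
    have h := hT.sum_degree_mul_dist j
    calc _ = (c + T.degree j) *
          (c * ∑ i, (T.dist i j : ℝ) + ∑ i, (T.degree i : ℝ) * T.dist i j) := by
          rw [Finset.mul_sum, ← Finset.sum_add_distrib, Finset.mul_sum]
          exact Finset.sum_congr rfl fun i _ => by ring
      _ = _ := by rw [h]; ring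
  have hW : ∑ j, ∑ i, (T.dist i j : ℝ) = T.totalDist := by
    rw [Finset.sum_comm, totalDist]
  have hX : ∑ j, (T.degree j : ℝ) * ∑ i, (T.dist i j : ℝ) = 2 * T.totalDist - k * (k - 1) := by
    have hY : ∀ y, ∑ x, (T.degree x : ℝ) * T.dist y x = 2 * ∑ i, (T.dist i y : ℝ) - (k - 1) := by
      intro y
      rw [← hT.sum_degree_mul_dist y]
      exact Finset.sum_congr rfl fun x _ => by rw [T.dist_comm]
    simp only [Finset.mul_sum]
    rw [Finset.sum_comm]
    simp only [hY, Finset.sum_sub_distrib, ← Finset.mul_sum, hW]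
    simp [k, mul_sub]
  have hD : ∑ j, (T.degree j : ℝ) = 2 * (k - 1) := hT.totalDegree_eq
  rw [Finset.sum_comm]
  simp only [h1]
  have h2 : ∀ j, (c + T.degree j) * ((c + 2) * ∑ i, (T.dist i j : ℝ) - (k - 1)) =
      c * (c + 2) * ∑ i, (T.dist i j : ℝ) + (c + 2) * (T.degree j * ∑ i, (T.dist i j : ℝ))
        - c * (k - 1) - T.degree j * (k - 1) := fun j => by ring
  simp only [h2, Finset.sum_sub_distrib, Finset.sum_add_distrib, ← Finset.mul_sum, hW, hX,
    ← Finset.sum_mul, hD, Finset.sum_const, Finset.card_univ, nsmul_eq_mul]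
  rw [show (Fintype.card ι : ℝ) = k from rfl]
  ring

/-- Among trees on a given vertex set, stars minimize the total distance. -/
lemma IsTree.totalDist_starGraph_le (hT : T.IsTree) (c : ι) :
    (starGraph c).totalDist ≤ T.totalDist := by
  -- Nonadjacent distinct vertices are at distance at least 2. The resulting lower bound depends
  -- only on the number of edges, so it is common to all trees; diameter at most 2 attains it.
  have key : ∀ S : SimpleGraph ι, S.IsTree →
      ∑ i, ∑ j, ((if i ≠ j then (2 : ℝ) else 0) - if S.Adj i j then 1 else 0) =
        2 * (Fintype.card ι - 1) * (Fintype.card ι - 1) := by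
    intro S hS
    simp only [Finset.sum_sub_distrib]
    rw [sum_sum_ite_adj S (fun _ => 1), Finset.sum_comm]
    have := hS.totalDegree_eq
    rw [totalDegree] at this
    simp only [sum_ite_ne, mul_one, this, Finset.sum_const, Finset.card_univ, nsmul_eq_mul]
    ring
  have upper : ∀ S : SimpleGraph ι, (∀ i j, S.dist i j ≤ 2) → S.totalDist ≤
      ∑ i, ∑ j, ((if i ≠ j then (2 : ℝ) else 0) - if S.Adj i j then 1 else 0) := by
    refine fun S hS => Finset.sum_le_sum fun i _ => Finset.sum_le_sum fun j _ => ?_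
    by_cases hij : i = j
    · simp [hij]
    · by_cases ha : S.Adj i j
      · rw [if_pos hij, if_pos ha, dist_eq_one_iff_adj.2 ha]
        norm_num
      · rw [if_pos hij, if_neg ha, sub_zero]
        exact_mod_cast hS i j
  have hstar : ∀ i, (starGraph c).dist i c ≤ 1 := by
    intro i
    by_cases hi : c = i
    · simp [hi]
    · exact (dist_eq_one_iff_adj.2 (starGraph_center_adj' hi)).le
  calc (starGraph c).totalDist
      ≤ _ := upper _ fun i j => by
        have h1 := (connected_starGraph c).dist_triangle (u := i) (v := c) (w := j)
        have h2 := hstar i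
        have h3 := hstar j
        rw [dist_comm] at h3
        omega
    _ = ∑ i, ∑ j, ((if i ≠ j then (2 : ℝ) else 0) - if T.Adj i j then 1 else 0) := by
        rw [key _ (isTree_starGraph c), key _ hT]
    _ ≤ T.totalDist := by
        refine Finset.sum_le_sum fun i _ => Finset.sum_le_sum fun j _ => ?_
        by_cases hij : i = j
        · simp [hij]
        · by_cases ha : T.Adj i j
          · rw [if_pos hij, if_pos ha, dist_eq_one_iff_adj.2 ha]
            norm_num
          · rw [if_pos hij, if_neg ha, sub_zero]
            exact_mod_cast hT.connected.one_lt_dist_of_ne_of_not_adj hij ha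

end Tree

end SimpleGraph

/-! ### Resistances in a chain of copies -/

namespace SimpleGraph

section Chain

open Classical

variable {ι V : Type*} {T : SimpleGraph ι} {H : SimpleGraph V} {b : ι → ι → V}

lemma Connected.chainOfCopies (hT : T.Connected) (hH : H.Connected) (b : ι → ι → V) :
    (T.chainOfCopies H b).Connected := by
  have hcopy : ∀ i x y, (T.chainOfCopies H b).Reachable (i, x) (i, y) := by
    intro i x y
    obtain ⟨w⟩ := hH.preconnected x y
    induction w with
    | nil => exact Reachable.refl _
    | cons h _ ih => exact (Adj.reachable (Or.inl ⟨rfl, h⟩)).trans ih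
  have hall : ∀ i j x y, (T.chainOfCopies H b).Reachable (i, x) (j, y) := by
    intro i j x y
    obtain ⟨w⟩ := hT.preconnected i j
    induction w generalizing x with
    | nil => exact hcopy _ x y
    | @cons i l _ h _ ih =>
      have h1 : (T.chainOfCopies H b).Adj (i, b i l) (l, b l i) := Or.inr ⟨h, rfl, rfl⟩
      exact ((hcopy i x _).trans h1.reachable).trans (ih _)
  have := hT.nonempty
  have := hH.nonempty
  exact Connected.mk fun p q => hall p.1 q.1 p.2 q.2

/-- Auxiliary recursion for `chainKernel`; the first argument is the distance in the tree. -/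
noncomputable def chainKernelAux (T : SimpleGraph ι) (r : V → V → ℝ) (b : ι → ι → V) :
    ℕ → ι → V → ι → V → ℝ
  | 0, _, x, _, y => r x y
  | n + 1, i, x, j, y => r x (b i (T.towards i j)) +
      (1 + chainKernelAux T r b n (T.towards i j) (b (T.towards i j) i) j y)

/-- The resistances in a chain of copies along a tree: resistances in the copies and in the
bridges add up along the path in the tree. -/
noncomputable def chainKernel (T : SimpleGraph ι) (r : V → V → ℝ) (b : ι → ι → V)
    (p q : ι × V) : ℝ :=
  chainKernelAux T r b (T.dist p.1 q.1) p.1 p.2 q.1 q.2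

lemma chainKernel_same (T : SimpleGraph ι) (r : V → V → ℝ) (b : ι → ι → V) (i : ι) (x y : V) :
    chainKernel T r b (i, x) (i, y) = r x y := by
  simp [chainKernel, chainKernelAux]

lemma Connected.chainKernel_of_ne (hT : T.Connected) (r : V → V → ℝ) (b : ι → ι → V) {i j : ι}
    (hij : i ≠ j) (x y : V) :
    chainKernel T r b (i, x) (j, y) = r x (b i (T.towards i j)) +
      (1 + chainKernel T r b (T.towards i j, b (T.towards i j) i) (j, y)) := by
  simp only [chainKernel]
  rw [(hT.towards_spec hij).2, chainKernelAux]

/-- At the end farther from `q`, the recursion starts on the bridge itself, so `r` contributes 0 and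
only the unit resistance of the bridge remains. -/
lemma IsTree.chainKernel_sub_of_adj (hT : T.IsTree) {r : V → V → ℝ} (hr : ∀ x, r x x = 0)
    (b : ι → ι → V) {i l : ι} (hil : T.Adj i l) (q : ι × V) :
    chainKernel T r b (i, b i l) q - chainKernel T r b (l, b l i) q =
      if i ≠ q.1 ∧ l = T.towards i q.1 then 1 else -1 := by
  obtain ⟨j, y⟩ := q
  rcases hT.eq_towards_or hil j with h | h
  · rw [if_pos h, hT.connected.chainKernel_of_ne r b h.1, ← h.2, hr]
    ring
  · rw [if_neg fun h' => hT.not_eq_towards_and h' h, hT.connected.chainKernel_of_ne r b h.1,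
      ← h.2, hr]
    ring

/-- Take for `z` and `w` the outer ends of the first and last bridges on the tree path. The bridges
contribute the distance, and resistances across intermediate copies are dropped. -/
lemma Connected.exists_le_chainKernel (hT : T.Connected) {r : V → V → ℝ}
    (hr : ∀ x y, 0 ≤ r x y) (b : ι → ι → V) {i j : ι} (hij : i ≠ j) :
    ∃ z w, ∀ x y, r x z + T.dist i j + r w y ≤ chainKernel T r b (i, x) (j, y) := by
  obtain ⟨n, hn⟩ : ∃ n, T.dist i j = n := ⟨_, rfl⟩
  induction n generalizing i with
  | zero => exact absurd (hT.dist_eq_zero_iff.1 hn) hij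
  | succ n ih =>
    have h := (hT.towards_spec hij).2
    have h' : (T.dist i j : ℝ) = T.dist (T.towards i j) j + 1 := by exact_mod_cast h
    by_cases hlj : T.towards i j = j
    · refine ⟨b i j, b j i, fun x y => ?_⟩
      rw [hT.chainKernel_of_ne r b hij, h', hlj, chainKernel_same, dist_self]
      apply le_of_eq
      push_cast
      ring
    · obtain ⟨z, w, hw⟩ := ih hlj (by omega)
      refine ⟨b i (T.towards i j), w, fun x y => ?_⟩
      rw [hT.chainKernel_of_ne r b hij, h']
      have h1 := hw (b (T.towards i j) i) y
      have h2 := hr (b (T.towards i j) i) z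
      linarith

/-- Intermediate copies are entered and left at `v`, so they cost `r v v = 0`. -/
lemma Connected.chainKernel_eq_of_forall_eq (hT : T.Connected) {r : V → V → ℝ}
    (hr : ∀ x, r x x = 0) {v : V} (hb : ∀ i j, T.Adj i j → b i j = v) {i j : ι} (hij : i ≠ j)
    (x y : V) :
    chainKernel T r b (i, x) (j, y) = r x v + T.dist i j + r v y := by
  obtain ⟨n, hn⟩ : ∃ n, T.dist i j = n := ⟨_, rfl⟩
  induction n generalizing i x with
  | zero => exact absurd (hT.dist_eq_zero_iff.1 hn) hij
  | succ n ih =>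
    obtain ⟨ha, h⟩ := hT.towards_spec hij
    have h' : (T.dist i j : ℝ) = T.dist (T.towards i j) j + 1 := by exact_mod_cast h
    rw [hT.chainKernel_of_ne r b hij, h', hb _ _ ha, hb _ _ ha.symm]
    by_cases hlj : T.towards i j = j
    · rw [hlj, chainKernel_same, dist_self]
      push_cast
      ring
    · rw [ih hlj v (by omega), hr]
      ring

variable [Fintype ι]

/-- The number of bridges attached at `x` in the `i`-th copy. -/
noncomputable def numBridges (T : SimpleGraph ι) (b : ι → ι → V) (i : ι) (x : V) : ℝ :=
  ∑ l, if T.Adj i l ∧ x = b i l then 1 else 0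

lemma numBridges_nonneg (T : SimpleGraph ι) (b : ι → ι → V) (i : ι) (x : V) :
    0 ≤ numBridges T b i x :=
  Finset.sum_nonneg fun _ _ => by split_ifs <;> norm_num

lemma numBridges_of_forall_eq {v : V} (hb : ∀ i j, T.Adj i j → b i j = v) (i : ι) (x : V) :
    numBridges T b i x = if x = v then (T.degree i : ℝ) else 0 := by
  have h : ∀ l, (T.Adj i l ∧ x = b i l) ↔ (T.Adj i l ∧ x = v) := fun l =>
    and_congr_right fun hl => by rw [hb i l hl]
  simp only [numBridges, h, degree_eq_sum]
  by_cases hx : x = v <;> simp [hx]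

variable [Fintype V]

lemma sum_ite_chainOfCopies_adj (T : SimpleGraph ι) (H : SimpleGraph V) (b : ι → ι → V)
    (i : ι) (x : V) (f : ι × V → ℝ) :
    ∑ q, (if (T.chainOfCopies H b).Adj (i, x) q then f q else 0) =
      (∑ y, if H.Adj x y then f (i, y) else 0) +
        ∑ l, if T.Adj i l ∧ x = b i l then f (l, b l i) else 0 := by
  have h : ∀ l y, (if (T.chainOfCopies H b).Adj (i, x) (l, y) then f (l, y) else 0) =
      (if i = l then (if H.Adj x y then f (l, y) else 0) else 0) +
      (if y = b l i then (if T.Adj i l ∧ x = b i l then f (l, y) else 0) else 0) := by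
    intro l y
    simp only [chainOfCopies]
    by_cases hil : i = l
    · subst hil
      simp
    · simp only [hil, false_and, false_or, if_false, zero_add]
      rw [← ite_and]
      exact if_congr (by tauto) rfl rfl
  rw [Fintype.sum_prod_type]
  simp only [h, Finset.sum_add_distrib]
  rw [Finset.sum_comm]
  simp

lemma sum_numBridges (T : SimpleGraph ι) (b : ι → ι → V) (i : ι) :
    ∑ x, numBridges T b i x = T.degree i := by
  simp only [numBridges]
  rw [Finset.sum_comm, degree_eq_sum]
  refine Finset.sum_congr rfl fun l _ => ?_
  by_cases h : T.Adj i l <;> simp [h]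

lemma degree_chainOfCopies (T : SimpleGraph ι) (H : SimpleGraph V) (b : ι → ι → V)
    (i : ι) (x : V) :
    ((T.chainOfCopies H b).degree (i, x) : ℝ) = H.degree x + numBridges T b i x := by
  rw [degree_eq_sum, sum_ite_chainOfCopies_adj T H b i x (fun _ => 1), degree_eq_sum, numBridges]

lemma lap_chainOfCopies (T : SimpleGraph ι) (H : SimpleGraph V) (b : ι → ι → V)
    (u : ι × V → ℝ) (i : ι) (x : V) :
    (T.chainOfCopies H b).lap u (i, x) = H.lap (fun y => u (i, y)) x +
      ∑ l, if T.Adj i l ∧ x = b i l then u (i, b i l) - u (l, b l i) else 0 := by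
  rw [lap_apply, sum_ite_chainOfCopies_adj T H b i x (fun q => u (i, x) - u q), lap_apply]
  congr 1
  refine Finset.sum_congr rfl fun l _ => ?_
  split_ifs with h
  · rw [h.2]
  · rfl

/-- Every bridge contributes -1 at its end, except +1 for the bridge leading towards `q`. In a copy
not containing `q`, this excess of 2 at the exit vertex cancels the -2 from the Laplacian of `r`
based there. -/
theorem IsTree.isResistanceKernel_chainKernel (hT : T.IsTree) {r : V → V → ℝ} {t : V → ℝ}
    (hr : H.IsResistanceKernel r t) (b : ι → ι → V) :
    (T.chainOfCopies H b).IsResistanceKernel (chainKernel T r b)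
      (fun p => t p.2 - numBridges T b p.1 p.2) := by
  refine ⟨fun q => (chainKernel_same T r b q.1 q.2 q.2).trans (hr.diag _), ?_⟩
  rintro ⟨j, y⟩ ⟨i, x⟩
  have h1 : ∑ l, (if T.Adj i l ∧ x = b i l then chainKernel T r b (i, b i l) (j, y)
        - chainKernel T r b (l, b l i) (j, y) else 0) =
      (if i ≠ j ∧ x = b i (T.towards i j) then 2 else 0) - numBridges T b i x := by
    have h2 : ∀ l, (if T.Adj i l ∧ x = b i l then chainKernel T r b (i, b i l) (j, y)
        - chainKernel T r b (l, b l i) (j, y) else 0) =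
        (if l = T.towards i j then (if i ≠ j ∧ x = b i (T.towards i j) then 2 else 0) else 0)
          - if T.Adj i l ∧ x = b i l then 1 else 0 := by
      intro l
      by_cases hl : T.Adj i l ∧ x = b i l
      · rw [if_pos hl, if_pos hl, hT.chainKernel_sub_of_adj hr.diag b hl.1]
        by_cases h : i ≠ j ∧ l = T.towards i j
        · rw [if_pos h, if_pos h.2, if_pos ⟨h.1, h.2 ▸ hl.2⟩]
          norm_num
        · rw [if_neg h]
          by_cases h3 : l = T.towards i j
          · rw [if_pos h3, if_neg fun h4 => h ⟨h4.1, h3⟩]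
            norm_num
          · rw [if_neg h3]
            norm_num
      · rw [if_neg hl, if_neg hl]
        by_cases h3 : l = T.towards i j
        · rw [if_pos h3, if_neg]
          · simp
          · rintro ⟨h4, h5⟩
            subst h3
            exact hl ⟨(hT.connected.towards_spec h4).1, h5⟩
        · simp [h3]
    simp only [h2, Finset.sum_sub_distrib, Finset.sum_ite_eq', Finset.mem_univ, if_true]
    rfl
  rw [lap_chainOfCopies, h1]
  by_cases hij : i = j
  · subst hij
    simp only [chainKernel_same, hr.lap_eq, ne_eq, not_true_eq_false, false_and, if_false,
      Prod.mk.injEq, true_and]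
    ring
  · have h2 : (fun z => chainKernel T r b (i, z) (j, y)) =
        (fun z => r z (b i (T.towards i j))) + fun _ =>
          1 + chainKernel T r b (T.towards i j, b (T.towards i j) i) (j, y) := by
      ext z
      exact hT.connected.chainKernel_of_ne r b hij z y
    rw [h2, map_add, lap_const, add_zero, hr.lap_eq]
    simp [hij]

end Chain

end SimpleGraph

/-! ### Comparing degree energies of chains -/

namespace SimpleGraph

section Energy

open Classical

variable {ι V : Type*} [Fintype ι] [Fintype V]

lemma sum_sum_add_mul_add_mul {r : V → V → ℝ} (hr : ∀ x y, r x y = r y x) (d e : V → ℝ) :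
    ∑ x, ∑ y, (d x + e x) * (d y + e y) * r x y =
      ∑ x, ∑ y, d x * d y * r x y + 2 * ∑ y, e y * ∑ x, d x * r x y
        + ∑ x, ∑ y, e x * e y * r x y := by
  have h1 : ∑ x, ∑ y, d x * e y * r x y = ∑ y, e y * ∑ x, d x * r x y := by
    rw [Finset.sum_comm]
    refine Finset.sum_congr rfl fun y _ => ?_
    rw [Finset.mul_sum]
    exact Finset.sum_congr rfl fun x _ => by ring
  have h2 : ∑ x, ∑ y, e x * d y * r x y = ∑ y, e y * ∑ x, d x * r x y := by
    refine Finset.sum_congr rfl fun y _ => ?_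
    rw [Finset.mul_sum]
    exact Finset.sum_congr rfl fun x _ => by rw [hr y x]; ring
  have h3 : ∀ x y, (d x + e x) * (d y + e y) * r x y = d x * d y * r x y + d x * e y * r x y
      + e x * d y * r x y + e x * e y * r x y := fun x y => by ring
  simp only [h3, Finset.sum_add_distrib, h1, h2]
  ring

lemma sum_sum_mul_mul_add_add {r : V → V → ℝ} (hr : ∀ x y, r x y = r y x) (A B : V → ℝ)
    (δ : ℝ) (z w : V) :
    ∑ x, ∑ y, A x * B y * (r x z + δ + r w y) =
      (∑ y, B y) * ∑ x, A x * r x z + (∑ x, A x) * (∑ y, B y) * δ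
        + (∑ x, A x) * ∑ y, B y * r y w := by
  have h : ∀ x y, A x * B y * (r x z + δ + r w y) =
      B y * (A x * r x z) + A x * (B y * δ) + A x * (B y * r y w) := fun x y => by
    rw [hr w y]
    ring
  simp only [h, Finset.sum_add_distrib, ← Finset.mul_sum, ← Finset.sum_mul]
  ring

/-- The degree energy of the chain of copies of `H` in which every bridge joins copies of a vertex
whose degree-weighted sum of resistances is `ρ`, split into contributions of pairs of copies. -/
noncomputable def chainEnergy (T : SimpleGraph ι) (H : SimpleGraph V) (ρ : ℝ) : ℝ :=
  ∑ i, ∑ j, if i = j then H.degreeEnergy H.effectiveResistance + 2 * T.degree i * ρ else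
    (H.totalDegree + T.degree i) * ρ + (H.totalDegree + T.degree j) * ρ
      + (H.totalDegree + T.degree i) * (H.totalDegree + T.degree j) * T.dist i j

variable {T : SimpleGraph ι} {H : SimpleGraph V}

lemma degreeEnergy_chainOfCopies (T : SimpleGraph ι) (H : SimpleGraph V) (b : ι → ι → V)
    (R : ι × V → ι × V → ℝ) :
    (T.chainOfCopies H b).degreeEnergy R = ∑ i, ∑ j, ∑ x, ∑ y,
      (H.degree x + numBridges T b i x) * (H.degree y + numBridges T b j y)
        * R (i, x) (j, y) := by
  simp only [degreeEnergy, Fintype.sum_prod_type, degree_chainOfCopies]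
  exact Finset.sum_congr rfl fun i _ => Finset.sum_comm

lemma sum_degree_add_numBridges (T : SimpleGraph ι) (H : SimpleGraph V) (b : ι → ι → V) (i : ι) :
    ∑ x, ((H.degree x : ℝ) + numBridges T b i x) = H.totalDegree + T.degree i := by
  rw [Finset.sum_add_distrib, sum_numBridges, totalDegree]

/-- Neither the tree's shape nor the attachments matter, so comparing Kemeny's constants amounts to
comparing degree energies. -/
lemma IsTree.totalDegree_chainOfCopies (hT : T.IsTree) (H : SimpleGraph V) (b : ι → ι → V) :
    (T.chainOfCopies H b).totalDegree =
      Fintype.card ι * H.totalDegree + 2 * (Fintype.card ι - 1) := by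
  have := hT.totalDegree_eq
  rw [totalDegree] at this
  rw [totalDegree, Fintype.sum_prod_type]
  simp only [degree_chainOfCopies, sum_degree_add_numBridges]
  rw [Finset.sum_add_distrib, this]
  simp

/-- The bound holds for each pair of copies. Within a copy, the two cross terms between degrees and
bridges each give `T.degree i * ρ`, and the bridge-bridge term is dropped. Between copies, use
`exists_le_chainKernel`; extra bridge weight only increases sums of resistances. -/
lemma Connected.chainEnergy_le_degreeEnergy (hT : T.Connected) (b : ι → ι → V) {ρ : ℝ}
    (hρ : ∀ w, ρ ≤ ∑ p, H.degree p * H.effectiveResistance p w) :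
    chainEnergy T H ρ ≤
      (T.chainOfCopies H b).degreeEnergy (chainKernel T H.effectiveResistance b) := by
  have hD : ∀ i x, (H.degree x : ℝ) ≤ H.degree x + numBridges T b i x := fun i x =>
    le_add_of_nonneg_right (numBridges_nonneg T b i x)
  have hD0 : ∀ i x, (0 : ℝ) ≤ H.degree x + numBridges T b i x := fun i x =>
    (Nat.cast_nonneg _).trans (hD i x)
  have hρ' : ∀ i w, ρ ≤ ∑ x, (H.degree x + numBridges T b i x) * H.effectiveResistance x w :=
    fun i w => (hρ w).trans (Finset.sum_le_sum fun x _ =>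
      mul_le_mul_of_nonneg_right (hD i x) (H.effectiveResistance_nonneg x w))
  have hvol : ∀ i, 0 ≤ ∑ x, ((H.degree x : ℝ) + numBridges T b i x) := fun i =>
    Finset.sum_nonneg fun x _ => hD0 i x
  rw [degreeEnergy_chainOfCopies]
  refine Finset.sum_le_sum fun i _ => Finset.sum_le_sum fun j _ => ?_
  by_cases hij : i = j
  · subst hij
    simp only [if_true, chainKernel_same]
    rw [sum_sum_add_mul_add_mul H.effectiveResistance_comm]
    have h1 : T.degree i * ρ ≤ ∑ y, numBridges T b i y *
        ∑ x, H.degree x * H.effectiveResistance x y := by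
      rw [← sum_numBridges T b i, Finset.sum_mul]
      exact Finset.sum_le_sum fun y _ =>
        mul_le_mul_of_nonneg_left (hρ y) (numBridges_nonneg T b i y)
    have h2 : 0 ≤ ∑ x, ∑ y, numBridges T b i x * numBridges T b i y *
        H.effectiveResistance x y :=
      Finset.sum_nonneg fun x _ => Finset.sum_nonneg fun y _ =>
        mul_nonneg (mul_nonneg (numBridges_nonneg T b i x) (numBridges_nonneg T b i y))
          (H.effectiveResistance_nonneg x y)
    rw [degreeEnergy]
    linarith
  · rw [if_neg hij]
    obtain ⟨z, w, hzw⟩ := hT.exists_le_chainKernel H.effectiveResistance_nonneg b hij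
    calc _ ≤ ∑ x, ∑ y, (H.degree x + numBridges T b i x) * (H.degree y + numBridges T b j y) *
          (H.effectiveResistance x z + T.dist i j + H.effectiveResistance w y) := by
          rw [sum_sum_mul_mul_add_add H.effectiveResistance_comm]
          have h1 := mul_le_mul_of_nonneg_left (hρ' i z) (hvol j)
          have h2 := mul_le_mul_of_nonneg_left (hρ' j w) (hvol i)
          simp only [sum_degree_add_numBridges] at h1 h2 ⊢
          linarith
      _ ≤ _ := Finset.sum_le_sum fun x _ => Finset.sum_le_sum fun y _ =>
          mul_le_mul_of_nonneg_left (hzw x y) (mul_nonneg (hD0 i x) (hD0 j y))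

/-- All bridge weight sits at `v`, where the resistance to `v` is zero, so nothing is lost in the
lower bound. -/
lemma Connected.degreeEnergy_eq_chainEnergy (hT : T.Connected) {b : ι → ι → V} {v : V}
    (hb : ∀ i j, T.Adj i j → b i j = v) (hr : ∀ x, H.effectiveResistance x x = 0) :
    (T.chainOfCopies H b).degreeEnergy (chainKernel T H.effectiveResistance b) =
      chainEnergy T H (∑ p, H.degree p * H.effectiveResistance p v) := by
  have hρ : ∀ i, ∑ x, (H.degree x + numBridges T b i x) * H.effectiveResistance x v =
      ∑ p, H.degree p * H.effectiveResistance p v := by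
    intro i
    refine Finset.sum_congr rfl fun x _ => ?_
    rw [numBridges_of_forall_eq hb]
    split_ifs with hx
    · rw [hx, hr]
      ring
    · rw [add_zero]
  rw [degreeEnergy_chainOfCopies]
  refine Finset.sum_congr rfl fun i _ => Finset.sum_congr rfl fun j _ => ?_
  by_cases hij : i = j
  · subst hij
    simp only [if_true, chainKernel_same]
    rw [sum_sum_add_mul_add_mul H.effectiveResistance_comm, degreeEnergy]
    simp only [numBridges_of_forall_eq hb, ite_mul, mul_ite, zero_mul, mul_zero,
      Finset.sum_ite_eq', Finset.mem_univ, if_true, hr]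
    ring
  · rw [if_neg hij]
    simp only [hT.chainKernel_eq_of_forall_eq hr hb hij]
    rw [sum_sum_mul_mul_add_add H.effectiveResistance_comm, hρ, hρ]
    simp only [sum_degree_add_numBridges]
    ring

/-- `chainEnergy` depends on the tree only through its number of vertices and its total
distance. -/
lemma IsTree.chainEnergy_eq (hT : T.IsTree) (H : SimpleGraph V) (ρ : ℝ) :
    chainEnergy T H ρ = Fintype.card ι * H.degreeEnergy H.effectiveResistance
      + 4 * (Fintype.card ι - 1) * ρ
      + 2 * (Fintype.card ι - 1) * ρ *
        (Fintype.card ι * H.totalDegree + 2 * (Fintype.card ι - 1))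
      + ((H.totalDegree + 2) ^ 2 * T.totalDist
        - (2 * H.totalDegree + 2) * Fintype.card ι * (Fintype.card ι - 1)
        - 2 * (Fintype.card ι - 1) ^ 2) := by
  have hD := hT.totalDegree_eq
  rw [totalDegree] at hD
  -- Extend the off-diagonal formula to `i = j`, where the distance is 0, and put the discrepancy in
  -- a diagonal term.
  have h : ∀ i j, (if i = j then H.degreeEnergy H.effectiveResistance + 2 * T.degree i * ρ else
      (H.totalDegree + T.degree i) * ρ + (H.totalDegree + T.degree j) * ρ
      + (H.totalDegree + T.degree i) * (H.totalDegree + T.degree j) * T.dist i j) =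
      (if i = j then H.degreeEnergy H.effectiveResistance + 2 * T.degree i * ρ
        - 2 * (H.totalDegree + T.degree i) * ρ else 0)
      + ((H.totalDegree + T.degree i) * ρ + (H.totalDegree + T.degree j) * ρ)
      + (H.totalDegree + T.degree i) * (H.totalDegree + T.degree j) * T.dist i j := by
    intro i j
    by_cases hij : i = j
    · subst hij
      simp only [if_true, dist_self]
      push_cast
      ring
    · simp only [hij, if_false, zero_add]
  rw [chainEnergy]
  simp only [h]
  simp only [Finset.sum_add_distrib (s := (Finset.univ : Finset ι)), Finset.sum_sub_distrib,
    Finset.sum_ite_eq, Finset.mem_univ, if_true, hT.sum_sum_mul_dist]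
  simp only [← Finset.mul_sum, ← Finset.sum_mul, Finset.sum_add_distrib, hD, Finset.sum_const,
    Finset.card_univ, nsmul_eq_mul]
  ring

lemma IsTree.chainEnergy_starGraph_le (hT : T.IsTree) (H : SimpleGraph V) (c : ι) (ρ : ℝ) :
    chainEnergy (starGraph c) H ρ ≤ chainEnergy T H ρ := by
  rw [(isTree_starGraph c).chainEnergy_eq, hT.chainEnergy_eq]
  gcongr
  exact hT.totalDist_starGraph_le c

lemma IsTree.kemenyConstant_chainOfCopies (hT : T.IsTree) (hH : H.Connected) (b : ι → ι → V) :
    (T.chainOfCopies H b).kemenyConstant =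
      (T.chainOfCopies H b).degreeEnergy (chainKernel T H.effectiveResistance b) /
        (2 * (Fintype.card ι * H.totalDegree + 2 * (Fintype.card ι - 1))) := by
  obtain ⟨t, ht⟩ := hH.exists_isResistanceKernel
  rw [(hT.isResistanceKernel_chainKernel ht b).kemenyConstant_eq
    (hT.connected.chainOfCopies hH b), hT.totalDegree_chainOfCopies]

/-- The chain along a star whose bridges join the copies of an accessible vertex minimizes
Kemeny's constant. -/
theorem IsTree.kemenyConstant_starGraph_chainOfCopies_le (hT : T.IsTree) (hH : H.Connected)
    {v : V} (hv : ∀ w, H.accessibilityIndex v ≤ H.accessibilityIndex w) {c : ι}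
    {a : ι → ι → V} (ha : ∀ i j, (starGraph c).Adj i j → a i j = v) (b : ι → ι → V) :
    ((starGraph c).chainOfCopies H a).kemenyConstant ≤ (T.chainOfCopies H b).kemenyConstant := by
  obtain ⟨t, ht⟩ := hH.exists_isResistanceKernel
  -- Nonnegativity of the common denominator suffices: it is zero for one copy of a single vertex.
  have h0 := totalDegree_nonneg (T.chainOfCopies H b)
  rw [hT.totalDegree_chainOfCopies] at h0
  rw [(isTree_starGraph c).kemenyConstant_chainOfCopies hH, hT.kemenyConstant_chainOfCopies hH,
    (connected_starGraph c).degreeEnergy_eq_chainEnergy ha ht.diag]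
  gcongr
  exact (hT.chainEnergy_starGraph_le H c _).trans
    (hT.connected.chainEnergy_le_degreeEnergy b fun w =>
      hH.sum_degree_mul_effectiveResistance_le (hv w))

end Energy

end SimpleGraph

theorem mainTheorem11 {V : Type*} [Fintype V] (H : SimpleGraph V) (hH : H.Connected)
    (v : V) (hv : ∀ w : V, H.accessibilityIndex v ≤ H.accessibilityIndex w)
    (k : ℕ) (c : Fin k) (a : Fin k → Fin k → V)
    (ha : ∀ i j : Fin k, (SimpleGraph.starGraph c).Adj i j → a i j = v) :
    IsLeast
      {x : ℝ | ∃ (T : SimpleGraph (Fin k)) (b : Fin k → Fin k → V),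
        T.IsTree ∧ x = (T.chainOfCopies H b).kemenyConstant}
      ((SimpleGraph.starGraph c).chainOfCopies H a).kemenyConstant := by
  refine ⟨⟨_, a, SimpleGraph.isTree_starGraph c, rfl⟩, ?_⟩
  rintro x ⟨T, b, hT, rfl⟩
  exact hT.kemenyConstant_starGraph_chainOfCopies_le hH hv ha b
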